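/- Let $\mathbb K\in\{\mathbb R,\mathbb C\}$, let $\mu$ be a probability measure on a measurable space $\mathcal S$, and let $f:\mathcal S\to\mathcal S$ be measurable with $\mu(f^{-1}(E))=0$ whenever $\mu(E)=0$ (for instance, $\mu$ is $f$-invariant). Let $\mathcal H$ be a closed subspace of $L^2(\mathcal S,\mu;\mathbb K)$ such that $\psi\circ f\in\mathcal H$ for all $\psi\in\mathcal H$, and let $\mathcal K:\mathcal H\to\mathcal H$, $\mathcal K\psi=\psi\circ f$, be the Koopman operator. Let $n,m\ge 1$, let $\Phi=(\phi_1,\dots,\phi_n)^\top:\mathcal S\to\mathbb R^n$ be measurable with $\phi_i\in\mathcal H$ for all $i$, let $\mathcal H_n=\operatorname{span}_{\mathbb K}\{\phi_1,\dots,\phi_n\}$, and let $\mathcal P_n$ be the orthogonal projection of $\mathcal H$ onto $\mathcal H_n$. Let $s_1,\dots,s_m$ be random points of $\mathcal S$, $s_k^+=f(s_k)$, and put $$\mathbf G_n=\mathbb E_{s\sim\mu}[\Phi(s)\Phi(s)^\top],\quad \mathbf G_{n,m}=\frac1m\sum_{k=1}^m\Phi(s_k)\Phi(s_k)^\top,\quad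 \mathbf A_{n,m}=\frac1m\sum_{k=1}^m\Phi(s_k^+)\Phi(s_k)^\top .$$ When $\mathbf G_{n,m}$ is invertible let $\mathbf K_{n,m}=\mathbf A_{n,m}\mathbf G_{n,m}^{-1}$ (the EDMD matrix), and let $\mathcal K_{n,m}:\mathcal H_n\to\mathcal H_n$ be the operator $c^\top\Phi\mapsto c^\top\mathbf K_{n,m}\Phi$. Assume: 1. (i.i.d. samples) $s_1,\dots,s_m$ are independent with law $\mu$. 2. (Bounded latent state) $\|\Phi(s)\|_2\le B$ for all $s\in\mathcal S$, where $B>0$. 3. (Well-conditioned Gram matrix) $\lambda_{\min}(\mathbf G_n)\ge\gamma>0$, and $\lambda_{\min}(\mathbf G_{n,m})\ge\gamma/2$ with probability at least $1-\delta_m$. 4. (Orthogonal basis) $\phi_1,\dots,\phi_n$ are orthonormal in $\mathcal H$; moreover $\mathcal K$ is diagonalized by orthonormal eigenfunctions: there is a finite or infinite orthonormal sequence $\phi_1^\star,\phi_2^\star,\dots$ in $\mathcal H$ with $\mathcal K\phi_i^\star=\lambda_i^\star\phi_i^\star$ such that $\mathcal K$ vanishes on the orthogonal complement of all the $\phi_i^\star$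 (in particular, this holds if the $\phi_i^\star$ form an orthonormal basis of $\mathcal H$). 5. (Bounded Koopman operator) $\|\mathcal K\|\le M<\infty$. 6. (Spectral decay) $|\lambda_1^\star|\ge|\lambda_2^\star|\ge\cdots$ and $|\lambda_i^\star|\le C/i^{\alpha}$ for all $i$, where $C>0$ and $\alpha>\tfrac12$. 7. (Subspace alignment) $\mathcal H_n=\operatorname{span}_{\mathbb K}\{\phi_1^\star,\dots,\phi_n^\star\}$. **Theorem (Error Bound).** For every $\delta>0$, with probability at least $1-2\delta-\delta_m$ the matrix $\mathbf G_{n,m}$ is invertible and, in the operator norm of $\mathcal H$, $$\|\mathcal K_{n,m}\mathcal P_n-\mathcal K\|\;\le\;\kappa_{\mathrm{bias}}\,\frac{\ln(2n/\delta)}{m}+\kappa_{\mathrm{var}}\sqrt{\frac{\ln(2n/\delta)}{m}}+\frac{C}{\sqrt{2\alpha-1}}\,n^{-(\alpha-1/2)},$$ where $$\kappa_{\mathrm{bias}}=\frac{4B^3}{3\sqrt{\gamma^3}}\Bigl(\frac{2B^2}{\gamma}+1\Bigr),\qquad \kappa_{\mathrm{var}}=\frac{2\sqrt2\,B^3}{\sqrt{\gamma^3}}\Bigl(\frac{2B^2}{\gamma}+1\Bigr).$$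 -/

import Mathlib

open MeasureTheory ProbabilityTheory

namespace KoopmanError

noncomputable section

/-! ### The Koopman operator -/

/-- The Koopman operator `ψ ↦ ψ ∘ f` on a subspace `H` of `L²(S, μ)` which is mapped to itself by
composition with `f`. Nonsingularity of `f` (null sets have null preimages; automatic when `μ` is
invariant) makes the composition well defined on almost-everywhere classes. -/
def koopman {𝕜 : Type*} [RCLike 𝕜] {S : Type*} [MeasurableSpace S] {μ : Measure S} {f : S → S}
    (hf : Measure.QuasiMeasurePreserving f μ μ) (H : Submodule 𝕜 (Lp 𝕜 2 μ))
    (hH : ∀ ψ ∈ H, ∃ χ ∈ H, (χ : S → 𝕜) =ᵐ[μ] (ψ : S → 𝕜) ∘ f) : H →ₗ[𝕜] H where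
  toFun ψ := ⟨(hH ψ ψ.2).choose, (hH ψ ψ.2).choose_spec.1⟩
  map_add' ψ₁ ψ₂ := by
    apply Subtype.ext
    apply Lp.ext
    refine ((hH _ (ψ₁ + ψ₂).2).choose_spec.2).trans ?_
    refine (hf.ae_eq (Lp.coeFn_add (ψ₁ : Lp 𝕜 2 μ) ψ₂)).trans ?_
    refine Filter.EventuallyEq.trans ?_ (Lp.coeFn_add _ _).symm
    exact ((hH _ ψ₁.2).choose_spec.2.add (hH _ ψ₂.2).choose_spec.2).symm
  map_smul' c ψ := by
    apply Subtype.ext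
    apply Lp.ext
    refine ((hH _ (c • ψ).2).choose_spec.2).trans ?_
    refine (hf.ae_eq (Lp.coeFn_smul c (ψ : Lp 𝕜 2 μ))).trans ?_
    refine Filter.EventuallyEq.trans ?_ (Lp.coeFn_smul _ _).symm
    exact ((hH _ ψ.2).choose_spec.2.const_smul c).symm

theorem koopman_ae_eq {𝕜 : Type*} [RCLike 𝕜] {S : Type*} [MeasurableSpace S] {μ : Measure S}
    {f : S → S} (hf : Measure.QuasiMeasurePreserving f μ μ) (H : Submodule 𝕜 (Lp 𝕜 2 μ))
    (hH : ∀ ψ ∈ H, ∃ χ ∈ H, (χ : S → 𝕜) =ᵐ[μ] (ψ : S → 𝕜) ∘ f) (ψ : H) :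
    ((koopman hf H hH ψ : Lp 𝕜 2 μ) : S → 𝕜) =ᵐ[μ] ((ψ : Lp 𝕜 2 μ) : S → 𝕜) ∘ f :=
  (hH ψ ψ.2).choose_spec.2

/-! ### The embedding and its Gram matrices -/

theorem memLp_feature (𝕜 : Type*) [RCLike 𝕜] {S : Type*} [MeasurableSpace S] (μ : Measure S)
    [IsFiniteMeasure μ] {n : ℕ} {Φ : S → EuclideanSpace ℝ (Fin n)} (hΦ : Measurable Φ) {B : ℝ}
    (hB : ∀ x, ‖Φ x‖ ≤ B) (i : Fin n) : MemLp (fun x => ((Φ x i : ℝ) : 𝕜)) 2 μ := by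
  refine MemLp.of_bound (C := B) ?_ ?_
  · exact (RCLike.measurable_ofReal.comp
      ((EuclideanSpace.proj (𝕜 := ℝ) i).measurable.comp hΦ)).aestronglyMeasurable
  · refine Filter.Eventually.of_forall fun x => ?_
    rw [RCLike.norm_ofReal, ← Real.norm_eq_abs]
    exact (PiLp.norm_apply_le (Φ x) i).trans (hB x)

/-- The `i`-th coordinate `φᵢ` of a bounded measurable embedding `Φ`, as an element of
`L²(S, μ)`. -/
def feature (𝕜 : Type*) [RCLike 𝕜] {S : Type*} [MeasurableSpace S] (μ : Measure S)
    [IsFiniteMeasure μ] {n : ℕ} {Φ : S → EuclideanSpace ℝ (Fin n)} (hΦ : Measurable Φ) {B : ℝ}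
    (hB : ∀ x, ‖Φ x‖ ≤ B) (i : Fin n) : Lp 𝕜 2 μ :=
  (memLp_feature 𝕜 μ hΦ hB i).toLp _

/-- The population Gram matrix `Gₙ = 𝔼[Φ(s) Φ(s)ᵀ]`, with `s` distributed as `μ`. -/
def gram {S : Type*} [MeasurableSpace S] (μ : Measure S) {n : ℕ}
    (Φ : S → EuclideanSpace ℝ (Fin n)) : Matrix (Fin n) (Fin n) ℝ :=
  Matrix.of fun i j => ∫ x, Φ x i * Φ x j ∂μ

/-- The empirical Gram matrix `G_{n,m} = (1/m) ∑ₖ Φ(sₖ) Φ(sₖ)ᵀ` of the sample `x`. -/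
def empGram {S : Type*} {n m : ℕ} (Φ : S → EuclideanSpace ℝ (Fin n)) (x : Fin m → S) :
    Matrix (Fin n) (Fin n) ℝ :=
  Matrix.of fun i j => (1 / (m : ℝ)) * ∑ k, Φ (x k) i * Φ (x k) j

/-- The empirical correlation matrix `A_{n,m} = (1/m) ∑ₖ Φ(sₖ⁺) Φ(sₖ)ᵀ`, where `sₖ⁺ = f(sₖ)`. -/
def empCorr {S : Type*} {n m : ℕ} (f : S → S) (Φ : S → EuclideanSpace ℝ (Fin n))
    (x : Fin m → S) : Matrix (Fin n) (Fin n) ℝ :=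
  Matrix.of fun i j => (1 / (m : ℝ)) * ∑ k, Φ (f (x k)) i * Φ (x k) j

/-- The EDMD matrix `K_{n,m} = A_{n,m} G_{n,m}⁻¹` (meaningful when `G_{n,m}` is invertible). -/
def edmdMatrix {S : Type*} {n m : ℕ} (f : S → S) (Φ : S → EuclideanSpace ℝ (Fin n))
    (x : Fin m → S) : Matrix (Fin n) (Fin n) ℝ :=
  empCorr f Φ x * (empGram Φ x)⁻¹

/-- The smallest eigenvalue of a real symmetric matrix (of positive size). -/
def minEigenvalue {n : ℕ} (A : Matrix (Fin n) (Fin n) ℝ) : ℝ := sInf (spectrum ℝ A)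

/-! ### Finite-rank operators given by matrices -/

/-- The operator `𝒦 Pₙ` on `H`: first project orthogonally onto `Hₙ = span {φ₁, …, φₙ}`, then
apply the operator `𝒦 : Hₙ → Hₙ`, `cᵀΦ ↦ cᵀKΦ`, i.e. `φᵢ ↦ ∑ⱼ Kᵢⱼ φⱼ`, that the real
matrix `K` defines in the basis `φ₁, …, φₙ`. -/
def matrixOperator {𝕜 : Type*} [RCLike 𝕜] {H : Type*} [NormedAddCommGroup H]
    [InnerProductSpace 𝕜 H] {n : ℕ} {φ : Fin n → H} (hφ : LinearIndependent 𝕜 φ)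
    (K : Matrix (Fin n) (Fin n) ℝ) : H →L[𝕜] H :=
  haveI : FiniteDimensional 𝕜 (Submodule.span 𝕜 (Set.range φ)) :=
    FiniteDimensional.span_of_finite 𝕜 (Set.finite_range φ)
  (Submodule.span 𝕜 (Set.range φ)).subtypeL ∘L
    (LinearMap.toContinuousLinearMap (Matrix.toLin (Module.Basis.span hφ) (Module.Basis.span hφ)
      (K.transpose.map (fun t : ℝ => (t : 𝕜))))) ∘L
    (Submodule.span 𝕜 (Set.range φ)).orthogonalProjectionOnto

/-! ### The constants of the sampling bound -/

def kappaBias (B γ : ℝ) : ℝ := 4 * B ^ 3 / (3 * Real.sqrt (γ ^ 3)) * (2 * B ^ 2 / γ + 1)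

def kappaVar (B γ : ℝ) : ℝ :=
  2 * Real.sqrt 2 * B ^ 3 / Real.sqrt (γ ^ 3) * (2 * B ^ 2 / γ + 1)

end

end KoopmanError

namespace KoopmanError

/-! ### Concentration of empirical averages -/

/-! Orthonormality forces the population Gram matrix to be the identity; hence `γ ≤ 1` and, taking
traces, `n ≤ B²`. By alignment the feature span is Koopman-invariant, and the Koopman operator acts
on it by the population correlation matrix `corr`. The triangle inequality through the operator of
`corr` splits the error in two.

Sampling: Hoeffding and a union bound over entries control the empirical matrices. A resolvent-type
identity (`norm_edmdMatrix_sub_le`) and the spectral lower bound on the empirical Gram matrix carry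
this over to the EDMD matrix in Frobenius norm, which dominates the operator norm. The result is
purely of order `√(log(2n/δ)/m)`, so the bias term is only added slack.

Truncation: on the complement of the span the operator is diagonal with eigenvalues at most
`C/(n+1)^α` (`norm_apply_le_of_diagonal`), and Bernoulli's inequality compares this with the stated
rate (`div_rpow_succ_le`). -/

theorem measureReal_sum_sub_mean_ge_le {S Ω : Type*} [MeasurableSpace S] [MeasurableSpace Ω]
    {μ : Measure S} {P : Measure Ω} [IsProbabilityMeasure P] {m : ℕ}
    {s : Fin m → Ω → S} (hlaw : ∀ k, HasLaw (s k) μ P) (hindep : iIndepFun s P)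
    {g : S → ℝ} (hg : Measurable g) {b : ℝ} (hgb : ∀ x, |g x| ≤ b) {t : ℝ} (ht : 0 ≤ t) :
    P.real {ω | t ≤ ∑ k, (g (s k ω) - ∫ x, g x ∂μ)} ≤ Real.exp (-t ^ 2 / (2 * (m * b ^ 2))) := by
  have hi : iIndepFun (fun k ω => g (s k ω) - ∫ x, g x ∂μ) P :=
    hindep.comp (fun _ x => g x - ∫ x, g x ∂μ) fun _ => hg.sub_const _
  have hsub : ∀ k ∈ Finset.univ, HasSubgaussianMGF (fun ω => g (s k ω) - ∫ x, g x ∂μ)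
      ((‖b - -b‖₊ / 2) ^ 2) P := by
    intro k _
    have h := hasSubgaussianMGF_of_mem_Icc (μ := P) (X := fun ω => g (s k ω)) (a := -b) (b := b)
      (hg.comp_aemeasurable (hlaw k).aemeasurable)
      (Filter.Eventually.of_forall fun ω => abs_le.1 (hgb _))
    have he : ∫ ω, g (s k ω) ∂P = ∫ x, g x ∂μ :=
      (hlaw k).integral_comp hg.aestronglyMeasurable
    simpa only [he] using h
  refine (HasSubgaussianMGF.measure_sum_ge_le_of_iIndepFun hi hsub ht).trans_eq ?_
  congr 3
  have : (b - -b) = 2 * b := by ring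
  simp [this]

/-- Hoeffding for both tails. The factor 2 in the threshold produces `2L` in the exponent, so that
`L = log(2n/δ)` can pay for a union over `n²` entries. -/
theorem measureReal_abs_average_sub_mean_gt_le {S Ω : Type*} [MeasurableSpace S]
    [MeasurableSpace Ω] {μ : Measure S} {P : Measure Ω} [IsProbabilityMeasure P] {m : ℕ}
    (hm : 1 ≤ m) {s : Fin m → Ω → S} (hlaw : ∀ k, HasLaw (s k) μ P) (hindep : iIndepFun s P)
    {g : S → ℝ} (hg : Measurable g) {b : ℝ} (hb : 0 < b) (hgb : ∀ x, |g x| ≤ b)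
    {L : ℝ} (hL : 0 ≤ L) :
    P.real {ω | 2 * b * Real.sqrt (L / m) < |1 / (m : ℝ) * ∑ k, g (s k ω) - ∫ x, g x ∂μ|} ≤
      2 * Real.exp (-(2 * L)) := by
  have hm0 : (0 : ℝ) < m := by exact_mod_cast hm
  set t := 2 * b * Real.sqrt (L / m) with ht
  have ht0 : 0 ≤ t := by positivity
  have hexp : Real.exp (-(m * t) ^ 2 / (2 * (m * b ^ 2))) = Real.exp (-(2 * L)) := by
    congr 1
    rw [ht, mul_pow, mul_pow, Real.sq_sqrt (by positivity)]
    field_simp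
  have h1 := measureReal_sum_sub_mean_ge_le hlaw hindep hg hgb (t := m * t) (by positivity)
  have h2 := measureReal_sum_sub_mean_ge_le hlaw hindep hg.neg (b := b)
    (fun x => by simpa using hgb x) (t := m * t) (by positivity)
  rw [hexp] at h1 h2
  refine le_trans ?_ ((measureReal_union_le _ _).trans
    ((add_le_add h1 h2).trans_eq (two_mul _).symm))
  refine measureReal_mono ?_ (measure_ne_top _ _)
  intro ω hω
  have hsum : 1 / (m : ℝ) * ∑ k, g (s k ω) - ∫ x, g x ∂μ =
      (∑ k, (g (s k ω) - ∫ x, g x ∂μ)) / m := by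
    rw [Finset.sum_sub_distrib]
    simp
    field_simp
  rw [Set.mem_ofPred_eq, hsum] at hω
  rcases lt_abs.1 hω with h | h
  · left
    rw [lt_div_iff₀ hm0] at h
    simp only [Set.mem_ofPred_eq]
    linarith
  · right
    rw [← neg_div, lt_div_iff₀ hm0] at h
    simp only [Set.mem_ofPred_eq, Pi.neg_apply, integral_neg, sub_neg_eq_add]
    have : ∑ k, (-g (s k ω) + ∫ x, g x ∂μ) = -∑ k, (g (s k ω) - ∫ x, g x ∂μ) := by
      rw [← Finset.sum_neg_distrib]
      exact Finset.sum_congr rfl fun k _ => by ring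
    rw [this]
    linarith

/-- Simultaneous control of all entries of an empirical cross-correlation matrix. -/
theorem measureReal_exists_entry_deviation_le {S Ω : Type*} [MeasurableSpace S]
    [MeasurableSpace Ω] {μ : Measure S} {P : Measure Ω} [IsProbabilityMeasure P] {n m : ℕ}
    (hn : 1 ≤ n) (hm : 1 ≤ m) {s : Fin m → Ω → S} (hlaw : ∀ k, HasLaw (s k) μ P)
    (hindep : iIndepFun s P) {u v : S → EuclideanSpace ℝ (Fin n)} (hu : Measurable u)
    (hv : Measurable v) {B : ℝ} (hB : 0 < B) (huB : ∀ x, ‖u x‖ ≤ B) (hvB : ∀ x, ‖v x‖ ≤ B)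
    {δ : ℝ} (hδ : 0 < δ) (hδ1 : δ ≤ 1) :
    P.real {ω | ∃ i j, 2 * B ^ 2 * Real.sqrt (Real.log (2 * n / δ) / m) <
      |1 / (m : ℝ) * ∑ k, u (s k ω) i * v (s k ω) j - ∫ x, u x i * v x j ∂μ|} ≤ δ := by
  have hn0 : (1 : ℝ) ≤ n := by exact_mod_cast hn
  have hL : 0 ≤ Real.log (2 * n / δ) := by
    apply Real.log_nonneg
    rw [le_div_iff₀ hδ]
    linarith
  have hexp : Real.exp (-(2 * Real.log (2 * n / δ))) = (δ / (2 * n)) ^ 2 := by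
    rw [two_mul, neg_add, Real.exp_add, Real.exp_neg, Real.exp_log (by positivity), inv_div, sq]
  have key : ∀ i j, P.real {ω | 2 * B ^ 2 * Real.sqrt (Real.log (2 * n / δ) / m) <
      |1 / (m : ℝ) * ∑ k, u (s k ω) i * v (s k ω) j - ∫ x, u x i * v x j ∂μ|} ≤
        2 * (δ / (2 * n)) ^ 2 := by
    intro i j
    rw [← hexp]
    refine measureReal_abs_average_sub_mean_gt_le hm hlaw hindep
      (g := fun x => u x i * v x j) ?_ (by positivity) ?_ hL
    · exact ((EuclideanSpace.proj (𝕜 := ℝ) i).measurable.comp hu).mul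
        ((EuclideanSpace.proj (𝕜 := ℝ) j).measurable.comp hv)
    · intro x
      rw [abs_mul, sq]
      exact mul_le_mul ((PiLp.norm_apply_le (u x) i).trans (huB x))
        ((PiLp.norm_apply_le (v x) j).trans (hvB x)) (abs_nonneg _) hB.le
  simp only [Set.ofPred_exists]
  -- The `n²` failure probabilities add up to `δ²/2`, which is at most `δ` because `δ ≤ 1`.
  calc _ ≤ ∑ i : Fin n, ∑ j : Fin n, 2 * (δ / (2 * n)) ^ 2 := by
        refine (measureReal_iUnion_fintype_le _).trans (Finset.sum_le_sum fun i _ => ?_)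
        exact (measureReal_iUnion_fintype_le _).trans (Finset.sum_le_sum fun j _ => key i j)
    _ = δ * (δ / 2) := by
        simp
        field_simp
    _ ≤ δ := by nlinarith

/-! ### Matrices -/

open scoped Matrix Matrix.Norms.Frobenius

theorem frobenius_norm_sq {l n : ℕ} (A : Matrix (Fin l) (Fin n) ℝ) :
    ‖A‖ ^ 2 = ∑ i, ∑ j, A i j ^ 2 := by
  rw [Matrix.frobenius_norm_def, ← Real.sqrt_eq_rpow, Real.sq_sqrt (by positivity)]
  simp

theorem frobenius_norm_le_of_abs_entry_le {n : ℕ} {A : Matrix (Fin n) (Fin n) ℝ} {t : ℝ}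
    (ht : 0 ≤ t) (h : ∀ i j, |A i j| ≤ t) : ‖A‖ ≤ n * t := by
  refine abs_le_of_sq_le_sq' ?_ (by positivity) |>.2
  rw [frobenius_norm_sq]
  calc _ ≤ ∑ i : Fin n, ∑ j : Fin n, t ^ 2 :=
        Finset.sum_le_sum fun i _ => Finset.sum_le_sum fun j _ => sq_le_sq' (abs_le.1 (h i j)).1
          (abs_le.1 (h i j)).2
    _ = (n * t) ^ 2 := by simp; ring

theorem minEigenvalue_one {n : ℕ} (hn : 1 ≤ n) :
    minEigenvalue (1 : Matrix (Fin n) (Fin n) ℝ) = 1 := by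
  have : Nonempty (Fin n) := ⟨⟨0, hn⟩⟩
  rw [minEigenvalue, spectrum.one_eq, csInf_singleton]

theorem empGram_isHermitian {S : Type*} {n m : ℕ} (Φ : S → EuclideanSpace ℝ (Fin n))
    (x : Fin m → S) : (empGram Φ x).IsHermitian := by
  ext i j
  simp [empGram, mul_comm]

theorem le_of_mem_spectrum_of_le_minEigenvalue {n : ℕ} {A : Matrix (Fin n) (Fin n) ℝ} {c : ℝ}
    (hc : c ≤ minEigenvalue A) {x : ℝ} (hx : x ∈ spectrum ℝ A) : c ≤ x :=
  hc.trans (csInf_le (Matrix.finite_real_spectrum).bddBelow hx)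

theorem isUnit_of_pos_le_minEigenvalue {n : ℕ} {A : Matrix (Fin n) (Fin n) ℝ} {c : ℝ}
    (hc0 : 0 < c) (hc : c ≤ minEigenvalue A) : IsUnit A := by
  by_contra h
  exact (le_of_mem_spectrum_of_le_minEigenvalue hc (spectrum.zero_mem ℝ h)).not_gt hc0

/-- Subtracting `c` shifts the spectrum into the nonnegative reals, so `A - c` is positive
semidefinite. -/
theorem mul_sq_le_of_le_minEigenvalue {n : ℕ} {A : Matrix (Fin n) (Fin n) ℝ}
    (hA : A.IsHermitian) {c : ℝ} (hc : c ≤ minEigenvalue A) (v : Fin n → ℝ) :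
    c * (v ⬝ᵥ v) ≤ v ⬝ᵥ A *ᵥ v := by
  have hps : (A - algebraMap ℝ _ c).PosSemidef := by
    rw [Matrix.posSemidef_iff_isHermitian_and_spectrum_nonneg]
    refine ⟨hA.sub ?_, fun x hx => ?_⟩
    · rw [Matrix.algebraMap_eq_diagonal]
      exact Matrix.isHermitian_diagonal _
    · rw [← spectrum.sub_singleton_eq] at hx
      obtain ⟨y, hy, z, rfl, rfl⟩ := Set.mem_sub.1 hx
      have := le_of_mem_spectrum_of_le_minEigenvalue hc hy
      simpa using this
  have h := hps.dotProduct_mulVec_nonneg v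
  rw [Matrix.sub_mulVec, Algebra.algebraMap_eq_smul_one, Matrix.smul_mulVec] at h
  simp [dotProduct_sub] at h
  linarith

/-- Right multiplication by the inverse of a symmetric matrix with spectrum above `c > 0` contracts
the Frobenius norm by at least `c`. -/
theorem frobenius_norm_mul_inv_le {n : ℕ} {A : Matrix (Fin n) (Fin n) ℝ}
    (hA : A.IsHermitian) {c : ℝ} (hc0 : 0 < c) (hc : c ≤ minEigenvalue A)
    (D : Matrix (Fin n) (Fin n) ℝ) : ‖D * A⁻¹‖ ≤ ‖D‖ / c := by
  have hU := isUnit_of_pos_le_minEigenvalue hc0 hc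
  rw [le_div_iff₀ hc0]
  refine abs_le_of_sq_le_sq' ?_ (by positivity) |>.2
  rw [mul_pow, frobenius_norm_sq, frobenius_norm_sq, Finset.sum_mul]
  refine Finset.sum_le_sum fun i _ => ?_
  set R := D * A⁻¹ with hR
  have hD : D = R * A := by
    rw [hR, Matrix.nonsing_inv_mul_cancel_right _ _ ((Matrix.isUnit_iff_isUnit_det _).1 hU)]
  -- For corresponding rows `r` of `R` and `d` of `D`: `c|r|² ≤ r·Ar = r·d ≤ |r||d|`. Squaring and
  -- cancelling `|r|²` gives the bound; a zero row is treated apart.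
  have h1 := mul_sq_le_of_le_minEigenvalue hA hc (R i)
  have h2 : R i ⬝ᵥ A *ᵥ R i = R i ⬝ᵥ D i := by
    conv_rhs => rw [hD]
    rw [Matrix.dotProduct_mulVec, dotProduct_comm]
    rfl
  have h3 : R i ⬝ᵥ R i = ∑ j, R i j ^ 2 := by simp [dotProduct, sq]
  have h4 := Finset.sum_mul_sq_le_sq_mul_sq Finset.univ (R i) (D i)
  rw [h2, h3] at h1
  change (R i ⬝ᵥ D i) ^ 2 ≤ _ at h4
  have h5 : 0 ≤ ∑ j, R i j ^ 2 := by positivity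
  have h6 : (c * ∑ j, R i j ^ 2) ^ 2 ≤ (∑ j, R i j ^ 2) * ∑ j, D i j ^ 2 :=
    (pow_le_pow_left₀ (by positivity) h1 2).trans h4
  rcases h5.eq_or_lt with h | h
  · rw [← h, zero_mul]
    positivity
  · refine le_of_mul_le_mul_left ?_ h
    linarith

/-! ### Operators given by matrices in an orthonormal system -/

theorem norm_sq_sum_smul {𝕜 : Type*} [RCLike 𝕜] {H : Type*} [NormedAddCommGroup H]
    [InnerProductSpace 𝕜 H] {ι : Type*} {e : ι → H} (he : Orthonormal 𝕜 e) (s : Finset ι)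
    (c : ι → 𝕜) : ‖∑ i ∈ s, c i • e i‖ ^ 2 = ∑ i ∈ s, ‖c i‖ ^ 2 := by
  have h := he.inner_sum c c s
  rw [inner_self_eq_norm_sq_to_K] at h
  have h2 : ∀ i, (starRingEnd 𝕜) (c i) * c i = ((‖c i‖ ^ 2 : ℝ) : 𝕜) := fun i => by
    rw [RCLike.conj_mul]; simp
  simp only [h2] at h
  exact_mod_cast h

section MatrixOperator

variable {𝕜 : Type*} [RCLike 𝕜] {H : Type*} [NormedAddCommGroup H] [InnerProductSpace 𝕜 H]
  {n : ℕ} {φ : Fin n → H}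

theorem eq_sum_inner_smul_of_mem_span (hφ : Orthonormal 𝕜 φ) {y : H}
    (hy : y ∈ Submodule.span 𝕜 (Set.range φ)) : y = ∑ i, inner 𝕜 (φ i) y • φ i := by
  obtain ⟨c, rfl⟩ := (Submodule.mem_span_range_iff_exists_fun 𝕜).1 hy
  exact Finset.sum_congr rfl fun i _ => by rw [hφ.inner_right_fintype]

theorem matrixOperator_apply (hφ : Orthonormal 𝕜 φ) (K : Matrix (Fin n) (Fin n) ℝ) (ψ : H) :
    matrixOperator hφ.linearIndependent K ψ =
      ∑ i, inner 𝕜 (φ i) ψ • ∑ j, (K i j : 𝕜) • φ j := by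
  have : FiniteDimensional 𝕜 (Submodule.span 𝕜 (Set.range φ)) :=
    FiniteDimensional.span_of_finite 𝕜 (Set.finite_range φ)
  have hp : (Submodule.span 𝕜 (Set.range φ)).orthogonalProjectionOnto ψ =
      ∑ i, inner 𝕜 (φ i) ψ • Module.Basis.span hφ.linearIndependent i := by
    apply Subtype.ext
    rw [eq_sum_inner_smul_of_mem_span hφ
      ((Submodule.span 𝕜 (Set.range φ)).orthogonalProjectionOnto ψ).2]
    simp only [Submodule.coe_sum, Submodule.coe_smul, Module.Basis.coe_span_apply]
    refine Finset.sum_congr rfl fun i _ => ?_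
    congr 1
    exact Submodule.inner_orthogonalProjectionOnto_eq_of_mem_left
      (⟨φ i, Submodule.subset_span ⟨i, rfl⟩⟩ : Submodule.span 𝕜 (Set.range φ)) ψ
  simp only [matrixOperator, ContinuousLinearMap.comp_apply, hp, map_sum, map_smul,
    Submodule.subtypeL_apply, LinearMap.coe_toContinuousLinearMap', Matrix.toLin_self,
    Module.Basis.coe_span_apply, Matrix.map_apply,
    Matrix.transpose_apply]

theorem matrixOperator_sub (hφ : Orthonormal 𝕜 φ) (K L : Matrix (Fin n) (Fin n) ℝ) :
    matrixOperator hφ.linearIndependent (K - L) =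
      matrixOperator hφ.linearIndependent K - matrixOperator hφ.linearIndependent L := by
  ext ψ
  simp only [sub_apply, matrixOperator_apply hφ, Matrix.sub_apply,
    RCLike.ofReal_sub, sub_smul, smul_sub, Finset.sum_sub_distrib]

/-- Cauchy–Schwarz in each output coordinate, then Bessel's inequality for the input coefficients.
-/
theorem norm_matrixOperator_le (hφ : Orthonormal 𝕜 φ) (K : Matrix (Fin n) (Fin n) ℝ) :
    ‖matrixOperator hφ.linearIndependent K‖ ≤ ‖K‖ := by
  refine ContinuousLinearMap.opNorm_le_bound _ (norm_nonneg _) fun ψ => ?_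
  refine abs_le_of_sq_le_sq' ?_ (by positivity) |>.2
  have h1 : matrixOperator hφ.linearIndependent K ψ =
      ∑ j, (∑ i, inner 𝕜 (φ i) ψ * (K i j : 𝕜)) • φ j := by
    rw [matrixOperator_apply hφ]
    simp only [Finset.smul_sum, smul_smul, Finset.sum_smul]
    exact Finset.sum_comm
  have hb : ∑ i, ‖inner 𝕜 (φ i) ψ‖ ^ 2 ≤ ‖ψ‖ ^ 2 := hφ.sum_inner_products_le ψ
  rw [h1, norm_sq_sum_smul hφ, mul_pow, frobenius_norm_sq, Finset.sum_comm, Finset.sum_mul]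
  refine Finset.sum_le_sum fun j _ => ?_
  calc ‖∑ i, inner 𝕜 (φ i) ψ * (K i j : 𝕜)‖ ^ 2
      ≤ (∑ i, |K i j| * ‖inner 𝕜 (φ i) ψ‖) ^ 2 := by
        gcongr
        refine (norm_sum_le _ _).trans_eq (Finset.sum_congr rfl fun i _ => ?_)
        rw [norm_mul, RCLike.norm_ofReal, mul_comm]
    _ ≤ (∑ i, |K i j| ^ 2) * ∑ i, ‖inner 𝕜 (φ i) ψ‖ ^ 2 :=
        Finset.sum_mul_sq_le_sq_mul_sq _ _ _
    _ ≤ (∑ i, K i j ^ 2) * ‖ψ‖ ^ 2 := by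
        simp only [sq_abs]
        gcongr

/-- If `T` leaves the span of an orthonormal system invariant, with matrix `A`, then `T` differs
from the operator of `A` at `ψ` by its value at the component of `ψ` orthogonal to the system. -/
theorem matrixOperator_sub_apply_eq (hφ : Orthonormal 𝕜 φ) {A : Matrix (Fin n) (Fin n) ℝ}
    {T : H →L[𝕜] H} (hT : ∀ i, T (φ i) = ∑ j, (A i j : 𝕜) • φ j) (ψ : H) :
    (matrixOperator hφ.linearIndependent A - T) ψ =
      -T (ψ - ∑ i, inner 𝕜 (φ i) ψ • φ i) := by
  simp [matrixOperator_apply hφ, hT]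

theorem inner_sub_sum_inner_smul (hφ : Orthonormal 𝕜 φ) (ψ : H) (i : Fin n) :
    inner 𝕜 (φ i) (ψ - ∑ j, inner 𝕜 (φ j) ψ • φ j) = 0 := by
  rw [inner_sub_right, hφ.inner_right_fintype, sub_self]

theorem norm_sub_sum_inner_smul_le (hφ : Orthonormal 𝕜 φ) (ψ : H) :
    ‖ψ - ∑ j, inner 𝕜 (φ j) ψ • φ j‖ ≤ ‖ψ‖ := by
  set q := ∑ j, inner 𝕜 (φ j) ψ • φ j with hq
  have h0 : inner 𝕜 q (ψ - q) = 0 := by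
    rw [hq, sum_inner]
    refine Finset.sum_eq_zero fun i _ => ?_
    rw [inner_smul_left, inner_sub_sum_inner_smul hφ, mul_zero]
  have h := norm_add_sq_eq_norm_sq_add_norm_sq_of_inner_eq_zero q (ψ - q) h0
  rw [add_sub_cancel] at h
  refine abs_le_of_sq_le_sq' ?_ (by positivity) |>.2
  nlinarith [mul_self_nonneg ‖q‖]

end MatrixOperator

/-! ### Tails of diagonal operators -/

/-- A continuous operator which is diagonal in an orthonormal system `e`, and vanishes on its
orthogonal complement, is bounded by `b` on the vectors orthogonal to those `eᵢ` whose eigenvalue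
may exceed `b`. -/
theorem norm_apply_le_of_diagonal {𝕜 : Type*} [RCLike 𝕜] {H : Type*} [NormedAddCommGroup H]
    [InnerProductSpace 𝕜 H] [CompleteSpace H] {ι : Type*} {e : ι → H} (he : Orthonormal 𝕜 e)
    {T : H →L[𝕜] H} {lam : ι → 𝕜} (heig : ∀ i, T (e i) = lam i • e i)
    (hker : ∀ ψ : H, (∀ i, inner 𝕜 (e i) ψ = 0) → T ψ = 0) {J : Set ι} {b : ℝ} (hb : 0 ≤ b)
    (hlam : ∀ i ∈ J, ‖lam i‖ ≤ b) {χ : H} (hχ : ∀ i ∉ J, inner 𝕜 (e i) χ = 0) :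
    ‖T χ‖ ≤ b * ‖χ‖ := by
  set W := (Submodule.span 𝕜 (e '' J)).topologicalClosure with hW
  -- On finite combinations the bound is Parseval; continuity of `T` extends it to the closure `W`.
  have hspan : ∀ ξ ∈ Submodule.span 𝕜 (e '' J), ‖T ξ‖ ≤ b * ‖ξ‖ := by
    intro ξ hξ
    obtain ⟨l, hl, rfl⟩ := (Finsupp.mem_span_image_iff_linearCombination 𝕜).1 hξ
    refine abs_le_of_sq_le_sq' ?_ (by positivity) |>.2
    rw [Finsupp.linearCombination_apply, Finsupp.sum, map_sum]
    simp only [map_smul, heig, smul_smul]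
    rw [norm_sq_sum_smul he, mul_pow, norm_sq_sum_smul he, Finset.mul_sum]
    refine Finset.sum_le_sum fun i hi => ?_
    rw [norm_mul, mul_pow, mul_comm]
    have := hlam i ((Finsupp.mem_supported 𝕜 l).1 hl hi)
    gcongr
  have hWT : ∀ ξ ∈ W, ‖T ξ‖ ≤ b * ‖ξ‖ := by
    intro ξ hξ
    exact closure_minimal (s := (Submodule.span 𝕜 (e '' J) : Set H)) (t := {ξ | ‖T ξ‖ ≤ b * ‖ξ‖})
      hspan (isClosed_le (by fun_prop) (by fun_prop)) hξ
  have : CompleteSpace W := (Submodule.isClosed_topologicalClosure _).completeSpace_coe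
  -- The residual is orthogonal to every `e i`: for `i ∈ J` by projection, for `i ∉ J` because both
  -- `χ` and all of `W` are. So `T` kills it.
  have hrest : T (χ - W.starProjection χ) = 0 := by
    refine hker _ fun i => ?_
    by_cases hi : i ∈ J
    · exact Submodule.sub_starProjection_mem_orthogonal χ (e i)
        (Submodule.le_topologicalClosure _ (Submodule.subset_span ⟨i, hi, rfl⟩))
    · rw [inner_sub_right, hχ i hi, zero_sub, neg_eq_zero]
      have hle : W ≤ (𝕜 ∙ e i)ᗮ := by
        refine Submodule.topologicalClosure_minimal _ (Submodule.span_le.2 ?_)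
          (Submodule.isClosed_orthogonal _)
        rintro _ ⟨j, hj, rfl⟩
        exact Submodule.mem_orthogonal_singleton_iff_inner_right.2
          (he.inner_eq_zero fun h => hi (h ▸ hj))
      exact Submodule.mem_orthogonal_singleton_iff_inner_right.1
        (hle (Submodule.starProjection_apply_mem W χ))
  rw [map_sub, sub_eq_zero] at hrest
  rw [hrest]
  refine (hWT _ (Submodule.starProjection_apply_mem W χ)).trans ?_
  gcongr
  exact W.norm_starProjection_apply_le χ

/-! ### Numerical bounds -/

/-- After squaring, the claim is `(2α-1) n^(2α-1) ≤ (n+1)^(2α)`. Bernoulli, valid since `2α ≥ 1`,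
gives `n (1+1/n)^(2α) ≥ n + 2α`, which is more than enough. -/
theorem div_rpow_succ_le {C α : ℝ} (hC : 0 < C) (hα : 1 / 2 < α) {n : ℕ} (hn : 1 ≤ n) :
    C / ((n : ℝ) + 1) ^ α ≤ C / Real.sqrt (2 * α - 1) * (n : ℝ) ^ (-(α - 1 / 2)) := by
  have hn0 : (0 : ℝ) < n := by exact_mod_cast hn
  have hα0 : 0 < 2 * α - 1 := by linarith
  have hs : 0 < Real.sqrt (2 * α - 1) := Real.sqrt_pos.2 hα0
  have hbern : 1 + 2 * α * (1 / n) ≤ (1 + 1 / (n : ℝ)) ^ (2 * α) :=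
    one_add_mul_self_le_rpow_one_add (by linarith [one_div_pos.2 hn0]) (by linarith)
  have hsq : ∀ x : ℝ, 0 < x → ∀ p : ℝ, (x ^ p) ^ 2 = x ^ (2 * p) := fun x hx p => by
    rw [← Real.rpow_natCast, ← Real.rpow_mul hx.le, mul_comm]
    norm_num
  have key : Real.sqrt (2 * α - 1) * (n : ℝ) ^ (α - 1 / 2) ≤ ((n : ℝ) + 1) ^ α := by
    refine abs_le_of_sq_le_sq' ?_ (by positivity) |>.2
    rw [mul_pow, Real.sq_sqrt hα0.le, hsq _ hn0, hsq _ (by positivity)]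
    have h1 : (n : ℝ) + 1 = n * (1 + 1 / n) := by field_simp
    have h2 : (n : ℝ) ^ (2 * (α - 1 / 2)) * n = n ^ (2 * α) := by
      rw [← Real.rpow_add_one hn0.ne']
      congr 1
      ring
    rw [h1, Real.mul_rpow hn0.le (by positivity), ← h2, mul_assoc, mul_comm]
    refine mul_le_mul_of_nonneg_left ?_ (by positivity)
    calc 2 * α - 1 ≤ n * (1 + 2 * α * (1 / n)) := by
          field_simp
          linarith
      _ ≤ _ := by gcongr
  rw [Real.rpow_neg hn0.le, ← div_eq_mul_inv, div_div]
  gcongr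

/-- The entrywise sampling bound is dominated by the variance term of the error bound. -/
theorem sampling_bound_le_kappaVar {n B γ : ℝ} (hγ : 0 < γ) (hγ1 : γ ≤ 1) (hn : 1 ≤ n)
    (hB : 0 < B) (hnB : n ≤ B ^ 2) {r : ℝ} (hr : 0 ≤ r) :
    (n * (2 * B ^ 2 * r) + B * (n * (2 * B ^ 2 * r))) / (γ / 2) ≤ kappaVar B γ * r := by
  have hB1 : 1 ≤ B := by nlinarith
  have hγs : 0 < Real.sqrt (γ ^ 3) := Real.sqrt_pos.2 (by positivity)
  have hγle : Real.sqrt (γ ^ 3) ≤ γ := by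
    rw [Real.sqrt_le_left hγ.le]
    nlinarith [sq_nonneg γ]
  have hsqrt : (1.4 : ℝ) ≤ Real.sqrt 2 := Real.le_sqrt_of_sq_le (by norm_num)
  have h1 : 2 * B ^ 2 ≤ 2 * B ^ 2 / γ := by
    rw [le_div_iff₀ hγ]
    nlinarith [sq_nonneg B]
  -- With `1.4` in place of `√2`, the difference is `1.6B² - 4B + 2.8`, whose minimum, at `B =
  -- 1.25`, is positive.
  have h2 : 4 * B * (1 + B) ≤ 2 * Real.sqrt 2 * (2 * B ^ 2 + 1) := by
    nlinarith [sq_nonneg (B - 1.25), sq_nonneg B]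
  calc (n * (2 * B ^ 2 * r) + B * (n * (2 * B ^ 2 * r))) / (γ / 2)
      = 4 * n * B ^ 2 * (1 + B) / γ * r := by field_simp; ring
    -- The dimension `n` is traded for `B²`, and `1/γ` for the larger `1/√(γ³)`.
    _ ≤ 4 * B ^ 2 * B ^ 2 * (1 + B) / Real.sqrt (γ ^ 3) * r := by gcongr
    _ = B ^ 3 / Real.sqrt (γ ^ 3) * (4 * B * (1 + B)) * r := by ring
    _ ≤ B ^ 3 / Real.sqrt (γ ^ 3) * (2 * Real.sqrt 2 * (2 * B ^ 2 / γ + 1)) * r := by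
        refine mul_le_mul_of_nonneg_right (mul_le_mul_of_nonneg_left (h2.trans ?_)
          (by positivity)) hr
        gcongr
    _ = kappaVar B γ * r := by rw [kappaVar]; ring

/-! ### Inner products of real-valued elements of `L²` -/

theorem inner_eq_ofReal_integral {𝕜 : Type*} [RCLike 𝕜] {S : Type*} [MeasurableSpace S]
    {μ : Measure S} {χ ψ : Lp 𝕜 2 μ} {u v : S → ℝ} (hu : (χ : S → 𝕜) =ᵐ[μ] fun x => (u x : 𝕜))
    (hv : (ψ : S → 𝕜) =ᵐ[μ] fun x => (v x : 𝕜)) :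
    inner 𝕜 χ ψ = ((∫ x, v x * u x ∂μ : ℝ) : 𝕜) := by
  rw [L2.inner_def, ← integral_ofReal]
  refine integral_congr_ae ?_
  filter_upwards [hu, hv] with x hx hy
  simp [hx, hy]

/-! ### Population moments of the features -/

section Feature

variable {𝕜 : Type*} [RCLike 𝕜] {S : Type*} [MeasurableSpace S] {μ : Measure S}
  [IsProbabilityMeasure μ] {n : ℕ} {Φ : S → EuclideanSpace ℝ (Fin n)} {hΦ : Measurable Φ} {B : ℝ}
  {hB : ∀ x, ‖Φ x‖ ≤ B}

theorem feature_ae_eq (hΦ : Measurable Φ) (hB : ∀ x, ‖Φ x‖ ≤ B) (i : Fin n) :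
    (feature 𝕜 μ hΦ hB i : S → 𝕜) =ᵐ[μ] fun x => ((Φ x i : ℝ) : 𝕜) :=
  (memLp_feature 𝕜 μ hΦ hB i).coeFn_toLp

theorem gram_eq_one (horth : Orthonormal 𝕜 (feature 𝕜 μ hΦ hB)) : gram μ Φ = 1 := by
  ext i j
  have h := (orthonormal_iff_ite.1 horth) j i
  rw [inner_eq_ofReal_integral (feature_ae_eq hΦ hB j) (feature_ae_eq hΦ hB i)] at h
  rw [gram, Matrix.of_apply, Matrix.one_apply]
  apply RCLike.ofReal_injective (K := 𝕜)
  rw [h]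
  simp only [eq_comm (a := j)]
  split_ifs <;> simp

theorem integrable_coord_mul {u v : S → EuclideanSpace ℝ (Fin n)} (hu : Measurable u)
    (hv : Measurable v) (huB : ∀ x, ‖u x‖ ≤ B) (hvB : ∀ x, ‖v x‖ ≤ B) (i j : Fin n) :
    Integrable (fun x => u x i * v x j) μ := by
  refine Integrable.of_bound (C := B * B) ?_ (Filter.Eventually.of_forall fun x => ?_)
  · exact (((EuclideanSpace.proj (𝕜 := ℝ) i).measurable.comp hu).mul
      ((EuclideanSpace.proj (𝕜 := ℝ) j).measurable.comp hv)).aestronglyMeasurable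
  · rw [norm_mul]
    have := (PiLp.norm_apply_le (u x) i).trans (huB x)
    exact mul_le_mul this ((PiLp.norm_apply_le (v x) j).trans (hvB x)) (norm_nonneg _)
      ((norm_nonneg _).trans this)

/-- The pointwise bound `‖u‖² ≤ B²` is integrated. It serves both for `Φ` and for `Φ ∘ f`, so
invariance of `μ` is not needed. -/
theorem sum_integral_sq_le {u : S → EuclideanSpace ℝ (Fin n)} (hu : Measurable u)
    (huB : ∀ x, ‖u x‖ ≤ B) : ∑ i, ∫ x, u x i * u x i ∂μ ≤ B ^ 2 := by
  have hint := fun i => integrable_coord_mul (μ := μ) hu hu huB huB i i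
  rw [← integral_finsetSum _ fun i _ => hint i]
  calc _ ≤ ∫ _, B ^ 2 ∂μ := by
        refine integral_mono (integrable_finsetSum _ fun i _ => hint i) (integrable_const _)
          fun x => ?_
        have h := EuclideanSpace.real_norm_sq_eq (u x)
        have h2 := pow_le_pow_left₀ (norm_nonneg _) (huB x) 2
        simp only [← sq]
        linarith
    _ = B ^ 2 := by simp

theorem card_le_sq_of_gram_eq_one (hΦ : Measurable Φ) (hB : ∀ x, ‖Φ x‖ ≤ B)
    (hG : gram μ Φ = 1) : (n : ℝ) ≤ B ^ 2 := by
  refine le_trans (le_of_eq ?_) (sum_integral_sq_le (μ := μ) hΦ hB)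
  have h : ∀ i, ∫ x, Φ x i * Φ x i ∂μ = 1 := fun i => by
    have := congrFun (congrFun hG i) i
    simpa [gram] using this
  simp [h]

end Feature

/-- The population correlation matrix `𝔼[Φ(f(s)) Φ(s)ᵀ]`. -/
noncomputable def corr {S : Type*} [MeasurableSpace S] (μ : Measure S) {n : ℕ} (f : S → S)
    (Φ : S → EuclideanSpace ℝ (Fin n)) : Matrix (Fin n) (Fin n) ℝ :=
  Matrix.of fun i j => ∫ x, Φ (f x) i * Φ x j ∂μ

/-! ### The correlation matrix as the matrix of the Koopman operator -/

section Koopman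

variable {𝕜 : Type*} [RCLike 𝕜] {S : Type*} [MeasurableSpace S] {μ : Measure S}
  [IsProbabilityMeasure μ] {f : S → S} {hf : Measure.QuasiMeasurePreserving f μ μ}
  {H : Submodule 𝕜 (Lp 𝕜 2 μ)}
  {hH : ∀ ψ ∈ H, ∃ χ ∈ H, (χ : S → 𝕜) =ᵐ[μ] (ψ : S → 𝕜) ∘ f}
  {n : ℕ} {Φ : S → EuclideanSpace ℝ (Fin n)} {hΦ : Measurable Φ} {B : ℝ}
  {hB : ∀ x, ‖Φ x‖ ≤ B} {hΦH : ∀ i, feature 𝕜 μ hΦ hB i ∈ H}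

theorem koopman_feature_ae_eq (i : Fin n) :
    ((koopman hf H hH ⟨feature 𝕜 μ hΦ hB i, hΦH i⟩ : Lp 𝕜 2 μ) : S → 𝕜) =ᵐ[μ]
      fun x => ((Φ (f x) i : ℝ) : 𝕜) :=
  (koopman_ae_eq hf H hH _).trans (hf.ae_eq (feature_ae_eq hΦ hB i))

theorem koopman_feature_eq_sum
    (horth : Orthonormal 𝕜 (fun i => (⟨feature 𝕜 μ hΦ hB i, hΦH i⟩ : H)))
    (hinv : ∀ i, koopman hf H hH ⟨feature 𝕜 μ hΦ hB i, hΦH i⟩ ∈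
      Submodule.span 𝕜 (Set.range fun i => (⟨feature 𝕜 μ hΦ hB i, hΦH i⟩ : H))) (i : Fin n) :
    koopman hf H hH ⟨feature 𝕜 μ hΦ hB i, hΦH i⟩ =
      ∑ j, (corr μ f Φ i j : 𝕜) • (⟨feature 𝕜 μ hΦ hB j, hΦH j⟩ : H) := by
  refine (eq_sum_inner_smul_of_mem_span horth (hinv i)).trans
    (Finset.sum_congr rfl fun j _ => ?_)
  congr 1
  rw [Submodule.coe_inner]
  exact inner_eq_ofReal_integral (feature_ae_eq hΦ hB j) (koopman_feature_ae_eq i)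

/-- Row `i` consists of the coefficients of the Koopman image of `φᵢ`, so Bessel bounds it by `∫ (Φᵢ
∘ f)²`; these integrals sum to at most `B²`. -/
theorem norm_corr_le (horth : Orthonormal 𝕜 (fun i => (⟨feature 𝕜 μ hΦ hB i, hΦH i⟩ : H)))
    (hf : Measure.QuasiMeasurePreserving f μ μ)
    (hH : ∀ ψ ∈ H, ∃ χ ∈ H, (χ : S → 𝕜) =ᵐ[μ] (ψ : S → 𝕜) ∘ f) (hB0 : 0 < B) :
    ‖corr μ f Φ‖ ≤ B := by
  refine abs_le_of_sq_le_sq' ?_ hB0.le |>.2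
  rw [frobenius_norm_sq]
  refine le_trans (Finset.sum_le_sum fun i _ => ?_)
    (sum_integral_sq_le (μ := μ) (hΦ.comp hf.measurable) fun x => hB (f x))
  have h1 := horth.sum_inner_products_le (s := Finset.univ)
    (koopman hf H hH ⟨feature 𝕜 μ hΦ hB i, hΦH i⟩)
  have h2 : ∀ j, inner 𝕜 (⟨feature 𝕜 μ hΦ hB j, hΦH j⟩ : H)
      (koopman hf H hH ⟨feature 𝕜 μ hΦ hB i, hΦH i⟩) = ((corr μ f Φ i j : ℝ) : 𝕜) := fun j => by
    rw [Submodule.coe_inner]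
    exact inner_eq_ofReal_integral (feature_ae_eq hΦ hB j) (koopman_feature_ae_eq i)
  have h3 : ‖koopman hf H hH ⟨feature 𝕜 μ hΦ hB i, hΦH i⟩‖ ^ 2 =
      ∫ x, Φ (f x) i * Φ (f x) i ∂μ := by
    apply RCLike.ofReal_injective (K := 𝕜)
    rw [RCLike.ofReal_pow, ← inner_self_eq_norm_sq_to_K, Submodule.coe_inner]
    exact inner_eq_ofReal_integral (koopman_feature_ae_eq i) (koopman_feature_ae_eq i)
  rw [h3] at h1
  simpa only [h2, RCLike.norm_ofReal, sq_abs, Function.comp_apply] using h1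

end Koopman

/-! ### The sampling error -/

/-- Deterministic perturbation bound for the EDMD matrix when the population Gram matrix is the
identity. -/
theorem norm_edmdMatrix_sub_le {S : Type*} {n m : ℕ} {f : S → S}
    {Φ : S → EuclideanSpace ℝ (Fin n)} {x : Fin m → S} {A : Matrix (Fin n) (Fin n) ℝ}
    {B c t : ℝ} (hc0 : 0 < c) (hc : c ≤ minEigenvalue (empGram Φ x)) (hB : 0 < B) (hA : ‖A‖ ≤ B)
    (hG : ‖empGram Φ x - 1‖ ≤ t) (hC : ‖empCorr f Φ x - A‖ ≤ t) :
    ‖edmdMatrix f Φ x - A‖ ≤ (t + B * t) / c := by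
  have hU := isUnit_of_pos_le_minEigenvalue hc0 hc
  -- Writing `A` as `A G G⁻¹`, with `G` the empirical Gram matrix, puts both sampling errors to the
  -- left of a single inverse.
  have h : edmdMatrix f Φ x - A =
      ((empCorr f Φ x - A) - A * (empGram Φ x - 1)) * (empGram Φ x)⁻¹ := by
    rw [mul_sub, mul_one, sub_sub_sub_cancel_right, sub_mul,
      Matrix.mul_nonsing_inv_cancel_right _ _ ((Matrix.isUnit_iff_isUnit_det _).1 hU), edmdMatrix]
  rw [h]
  refine (frobenius_norm_mul_inv_le (empGram_isHermitian Φ x) hc0 hc _).trans ?_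
  gcongr
  refine (norm_sub_le _ _).trans (add_le_add hC ((Matrix.frobenius_norm_mul _ _).trans ?_))
  gcongr

/-- If all entries of the empirical Gram and correlation matrices are `2 B² r`-close to those of
their expectations, then the EDMD operator is `κ_var r`-close to the population operator. -/
theorem norm_matrixOperator_edmdMatrix_sub_le {𝕜 : Type*} [RCLike 𝕜] {H : Type*}
    [NormedAddCommGroup H] [InnerProductSpace 𝕜 H] {S : Type*} [MeasurableSpace S] {μ : Measure S}
    {n m : ℕ} (hn : 1 ≤ n) {φ : Fin n → H} (hφ : Orthonormal 𝕜 φ) {f : S → S}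
    {Φ : S → EuclideanSpace ℝ (Fin n)} {x : Fin m → S} {B γ r : ℝ} (hγ : 0 < γ) (hB : 0 < B)
    (hgram : gram μ Φ = 1) (hγ1 : γ ≤ 1) (hnB : n ≤ B ^ 2) (hcorr : ‖corr μ f Φ‖ ≤ B) (hr : 0 ≤ r)
    (hx : γ / 2 ≤ minEigenvalue (empGram Φ x))
    (hG : ∀ i j, |empGram Φ x i j - gram μ Φ i j| ≤ 2 * B ^ 2 * r)
    (hC : ∀ i j, |empCorr f Φ x i j - corr μ f Φ i j| ≤ 2 * B ^ 2 * r) :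
    ‖matrixOperator hφ.linearIndependent (edmdMatrix f Φ x) -
      matrixOperator hφ.linearIndependent (corr μ f Φ)‖ ≤ kappaVar B γ * r := by
  rw [hgram] at hG
  rw [← matrixOperator_sub hφ]
  refine (norm_matrixOperator_le hφ _).trans ((norm_edmdMatrix_sub_le (half_pos hγ) hx hB hcorr
    (frobenius_norm_le_of_abs_entry_le (by positivity) hG)
    (frobenius_norm_le_of_abs_entry_le (by positivity) hC)).trans ?_)
  exact sampling_bound_le_kappaVar hγ hγ1 (by exact_mod_cast hn) hB hnB hr

/-! ### The truncation error -/

/-- The truncation error of a diagonal operator with polynomially decaying eigenvalues, when the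
orthonormal system `φ` spans the span of the `n` dominant eigenvectors. -/
theorem norm_matrixOperator_sub_le_of_decay {𝕜 : Type*} [RCLike 𝕜] {H : Type*}
    [NormedAddCommGroup H] [InnerProductSpace 𝕜 H] [CompleteSpace H] {n : ℕ} (hn : 1 ≤ n)
    {φ : Fin n → H} (hφ : Orthonormal 𝕜 φ) {A : Matrix (Fin n) (Fin n) ℝ} {T : H →L[𝕜] H}
    (hT : ∀ i, T (φ i) = ∑ j, (A i j : 𝕜) • φ j) {N : ℕ∞} {e : {i : ℕ // (i : ℕ∞) < N} → H}
    {lam : {i : ℕ // (i : ℕ∞) < N} → 𝕜} (he : Orthonormal 𝕜 e) (heig : ∀ i, T (e i) = lam i • e i)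
    (hker : ∀ ψ : H, (∀ i, inner 𝕜 (e i) ψ = 0) → T ψ = 0) {C α : ℝ} (hC : 0 < C)
    (hα : 1 / 2 < α) (hdecay : ∀ i, ‖lam i‖ ≤ C / ((i : ℕ) + 1 : ℝ) ^ α)
    (hspan : Submodule.span 𝕜 (Set.range φ) = Submodule.span 𝕜 (e '' {i | (i : ℕ) < n})) :
    ‖matrixOperator hφ.linearIndependent A - T‖ ≤
      C / Real.sqrt (2 * α - 1) * (n : ℝ) ^ (-(α - 1 / 2)) := by
  refine le_trans ?_ (div_rpow_succ_le hC hα hn)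
  refine ContinuousLinearMap.opNorm_le_bound _ (by positivity) fun ψ => ?_
  rw [matrixOperator_sub_apply_eq hφ hT, norm_neg]
  refine (norm_apply_le_of_diagonal he heig hker (J := {i | n ≤ (i : ℕ)})
    (b := C / ((n : ℝ) + 1) ^ α) (by positivity) ?_ ?_).trans ?_
  -- Indices start at 0, so the first discarded eigenvalue has index `n` and is bounded by
  -- `C/(n+1)^α`.
  · intro i hi
    refine (hdecay i).trans ?_
    have : (n : ℝ) ≤ (i : ℕ) := by exact_mod_cast hi
    gcongr
  · intro i hi
    have hmem : e i ∈ Submodule.span 𝕜 (Set.range φ) := by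
      rw [hspan]
      exact Submodule.subset_span ⟨i, show (i : ℕ) < n from lt_of_not_ge hi, rfl⟩
    obtain ⟨c, hc⟩ := (Submodule.mem_span_range_iff_exists_fun 𝕜).1 hmem
    rw [← hc, sum_inner]
    refine Finset.sum_eq_zero fun j _ => ?_
    rw [inner_smul_left, inner_sub_sum_inner_smul hφ, mul_zero]
  · gcongr
    exact norm_sub_sum_inner_smul_le hφ ψ

end KoopmanError

/-! ### The error bound -/

theorem mainTheorem3
    {𝕜 : Type*} [RCLike 𝕜]
    -- the dynamical system, the measure and the Hilbert space of observables
    {S : Type*} [MeasurableSpace S] (μ : Measure S) [IsProbabilityMeasure μ]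
    (f : S → S) (hf : Measure.QuasiMeasurePreserving f μ μ)
    (H : Submodule 𝕜 (Lp 𝕜 2 μ)) (hHclosed : IsClosed (H : Set (Lp 𝕜 2 μ)))
    (hH : ∀ ψ ∈ H, ∃ χ ∈ H, (χ : S → 𝕜) =ᵐ[μ] (ψ : S → 𝕜) ∘ f)
    -- the embedding, with coordinates in `H`, bounded by `B`
    (n : ℕ) (hn : 1 ≤ n) (Φ : S → EuclideanSpace ℝ (Fin n)) (hΦ : Measurable Φ)
    (B : ℝ) (hBpos : 0 < B) (hB : ∀ x, ‖Φ x‖ ≤ B)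
    (hΦH : ∀ i, KoopmanError.feature 𝕜 μ hΦ hB i ∈ H)
    -- i.i.d. samples `s k` with law `μ`; the successor of `s k` is `f (s k)`
    {Ω : Type*} [MeasurableSpace Ω] (P : Measure Ω) [IsProbabilityMeasure P]
    (m : ℕ) (hm : 1 ≤ m) (s : Fin m → Ω → S)
    (hlaw : ∀ k, HasLaw (s k) μ P) (hindep : iIndepFun s P)
    -- well-conditioned Gram matrices
    (γ : ℝ) (hγ : 0 < γ) (hgram : γ ≤ KoopmanError.minEigenvalue (KoopmanError.gram μ Φ))
    (δm : ℝ)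
    (hempGram : 1 - δm ≤ P.real {ω | γ / 2 ≤
      KoopmanError.minEigenvalue (KoopmanError.empGram Φ (fun k => s k ω))})
    -- orthonormal embedding functions
    (horth : Orthonormal 𝕜 (fun i => (⟨KoopmanError.feature 𝕜 μ hΦ hB i, hΦH i⟩ : H)))
    -- bounded Koopman operator
    (M : ℝ) (hM : ∀ ψ : H, ‖KoopmanError.koopman hf H hH ψ‖ ≤ M * ‖ψ‖)
    -- `N` (possibly infinite) orthonormal eigenfunctions which diagonalize the Koopman operator,
    -- with eigenvalues sorted by magnitude and decaying polynomially; index `i` stands for `i + 1`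
    (N : ℕ∞) (e : {i : ℕ // (i : ℕ∞) < N} → H) (lam : {i : ℕ // (i : ℕ∞) < N} → 𝕜)
    (he : Orthonormal 𝕜 e)
    (heig : ∀ i, KoopmanError.koopman hf H hH (e i) = lam i • e i)
    (hker : ∀ ψ : H, (∀ i, inner 𝕜 (e i) ψ = 0) → KoopmanError.koopman hf H hH ψ = 0)
    (hsorted : Antitone (fun i => ‖lam i‖))
    (C α : ℝ) (hC : 0 < C) (hα : 1 / 2 < α)
    (hdecay : ∀ i, ‖lam i‖ ≤ C / ((i : ℕ) + 1 : ℝ) ^ α)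
    -- the embedding spans the span of the `n` dominant eigenfunctions
    (hspan : Submodule.span 𝕜
        (Set.range fun i => (⟨KoopmanError.feature 𝕜 μ hΦ hB i, hΦH i⟩ : H)) =
      Submodule.span 𝕜 (e '' {i | (i : ℕ) < n}))
    (δ : ℝ) (hδ : 0 < δ) :
    1 - 2 * δ - δm ≤ P.real {ω |
      IsUnit (KoopmanError.empGram Φ (fun k => s k ω)) ∧
      ‖KoopmanError.matrixOperator horth.linearIndependent
            (KoopmanError.edmdMatrix f Φ (fun k => s k ω)) -
          (KoopmanError.koopman hf H hH).mkContinuous M hM‖ ≤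
        KoopmanError.kappaBias B γ * Real.log (2 * n / δ) / m
          + KoopmanError.kappaVar B γ * Real.sqrt (Real.log (2 * n / δ) / m)
          + C / Real.sqrt (2 * α - 1) * (n : ℝ) ^ (-(α - 1 / 2))} := by
  have : CompleteSpace H := hHclosed.completeSpace_coe
  have hn0 : (1 : ℝ) ≤ n := by exact_mod_cast hn
  have hδm : 0 ≤ δm := by linarith [measureReal_le_one (μ := P) (s := {ω | γ / 2 ≤
      KoopmanError.minEigenvalue (KoopmanError.empGram Φ (fun k => s k ω))})]
  -- For `δ > 1` the claimed probability is negative; otherwise `2n/δ ≥ 1` and the logarithm is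
  -- nonnegative.
  by_cases hδ1 : 1 < δ
  · exact le_trans (by linarith) measureReal_nonneg
  rw [not_lt] at hδ1
  have hG1 : KoopmanError.gram μ Φ = 1 :=
    KoopmanError.gram_eq_one (𝕜 := 𝕜) (hΦ := hΦ) (hB := hB)
      (horth.comp_linearIsometry H.subtypeₗᵢ)
  have hγ1 : γ ≤ 1 := by rwa [hG1, KoopmanError.minEigenvalue_one hn] at hgram
  have hnB : (n : ℝ) ≤ B ^ 2 := KoopmanError.card_le_sq_of_gram_eq_one hΦ hB hG1
  have hinv : ∀ y ∈ Submodule.span 𝕜 (e '' {i | (i : ℕ) < n}),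
      KoopmanError.koopman hf H hH y ∈ Submodule.span 𝕜 (e '' {i | (i : ℕ) < n}) := by
    refine fun y hy => Submodule.span_le (p := (Submodule.span 𝕜 (e '' {i | (i : ℕ) < n})).comap
      (KoopmanError.koopman hf H hH)) |>.2 ?_ hy
    rintro _ ⟨i, hi, rfl⟩
    rw [SetLike.mem_coe, Submodule.mem_comap, heig]
    exact Submodule.smul_mem _ _ (Submodule.subset_span ⟨i, hi, rfl⟩)
  have htrunc := KoopmanError.norm_matrixOperator_sub_le_of_decay hn horth
    (T := (KoopmanError.koopman hf H hH).mkContinuous M hM)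
    (KoopmanError.koopman_feature_eq_sum horth fun i => by
      rw [hspan]
      exact hinv _ (hspan ▸ Submodule.subset_span ⟨i, rfl⟩))
    he heig hker hC hα hdecay hspan
  have hL0 : 0 ≤ Real.log (2 * n / δ) := by
    apply Real.log_nonneg
    rw [le_div_iff₀ hδ]
    linarith
  have hbias : 0 ≤ KoopmanError.kappaBias B γ * Real.log (2 * n / δ) / m := by
    rw [KoopmanError.kappaBias]
    positivity
  have hbadG := KoopmanError.measureReal_exists_entry_deviation_le hn hm hlaw hindep hΦ hΦ hBpos
    hB hB hδ hδ1
  have hbadA := KoopmanError.measureReal_exists_entry_deviation_le hn hm hlaw hindep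
    (hΦ.comp hf.measurable) hΦ hBpos (fun x => hB (f x)) hB hδ hδ1
  -- Covering `U` by `Y ∪ V ∪ X` instead of taking complements uses only monotonicity and
  -- subadditivity, so no event has to be measurable.
  have hcover : ∀ U V X Y : Set Ω, (∀ ω ∈ U, ω ∉ V → ω ∉ X → ω ∈ Y) → P.real V ≤ δ →
      P.real X ≤ δ → 1 - δm ≤ P.real U → 1 - 2 * δ - δm ≤ P.real Y := by
    intro U V X Y h hV hX hU
    have h0 : U ⊆ Y ∪ (V ∪ X) := fun ω hω => by
      by_contra hn
      simp only [Set.mem_union, not_or] at hn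
      exact hn.1 (h ω hω hn.2.1 hn.2.2)
    have h1 := measureReal_mono h0 (measure_ne_top P _)
    have h2 := measureReal_union_le (μ := P) Y (V ∪ X)
    have h3 := measureReal_union_le (μ := P) V X
    linarith
  refine hcover _ _ _ _ (fun ω hω hV hX => ?_) hbadG hbadA hempGram
  simp only [Set.mem_ofPred_eq, not_exists, not_lt] at hω hV hX
  refine ⟨KoopmanError.isUnit_of_pos_le_minEigenvalue (half_pos hγ) hω, ?_⟩
  have hsamp := KoopmanError.norm_matrixOperator_edmdMatrix_sub_le hn horth hγ hBpos hG1 hγ1 hnB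
    (KoopmanError.norm_corr_le (𝕜 := 𝕜) horth hf hH hBpos) (Real.sqrt_nonneg _) hω hV hX
  refine (norm_sub_le_norm_sub_add_norm_sub _ (KoopmanError.matrixOperator
    horth.linearIndependent (KoopmanError.corr μ f Φ)) _).trans ?_
  exact add_le_add (hsamp.trans (le_add_of_nonneg_left hbias)) htrunc
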